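/- Let $G$ be a locally compact Hausdorff group with left Haar (Radon) measure, and let $L_\infty(G)=L_1(G)^*$. A mean on $L_\infty(G)$ is a positive linear functional $m\in L_\infty(G)^*$ with $m(1)=1$. The group $G$ is amenable if there is a mean $m$ on $L_\infty(G)$ with $m(l_tT)=m(T)$ for all $t\in G$ and $T\in L_\infty(G)$, where $l_tT(x)=T(t^{-1}x)$. Put $P_1(G)=\{f\in L_1(G): f\ge 0,\ \|f\|_1=1\}$. For $f\in L_1(G)$ and $T\in L_\infty(G)$ define $fT, Tf\in L_\infty(G)$ by $\langle fT,g\rangle=\langle T,f*g\rangle$ and $\langle Tf,g\rangle=\langle T,g*f\rangle$ for $g\in L_1(G)$, where $(f*g)(x)=\int_G f(s)g(s^{-1}x)\,ds$. Let $\mathrm{TLIM}(G)$ be the set of means $m$ with $m(fT)=m(T)$ for all $f\in P_1(G)$, $T\in L_\infty(G)$, and let $\mathrm{TIM}(G)$ be the set of $m\in\mathrm{TLIM}(G)$ that also satisfy $m(Tf)=m(T)$ for all $f\in P_1(G)$, $T\in L_\infty(G)$. Theorem. If $G$ is amenable and has an element $x$ whose conjugacy class $x^G=\{gxg^{-1}: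 g\in G\}$ is not precompact (that is, does not have compact closure in $G$), then $\mathrm{TLIM}(G)\ne\mathrm{TIM}(G)$. -/

import Mathlib

open MeasureTheory Filter Topology
open scoped ENNReal ComplexOrder

noncomputable section

namespace TopInvMean

variable {G : Type*} [Group G] [TopologicalSpace G] [IsTopologicalGroup G]
  [LocallyCompactSpace G] [MeasurableSpace G] [BorelSpace G]
  (μ : Measure G) [μ.IsHaarMeasure] [μ.Regular]

/-- The Banach space `L₁(G)` of complex functions, with respect to the left Haar measure `μ`. -/
abbrev LOne : Type _ := Lp ℂ 1 μ

/-- The Banach space `L_∞(G)`, realized as the dual of its predual `L₁(G)`. A bounded locally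
measurable function `T` (modulo locally null functions) is identified with the functional
`g ↦ ∫ T(x) g(x) dx`. On groups that are not σ-compact this is the usual meaning of `L_∞(G)`. -/
abbrev LInfty : Type _ := StrongDual ℂ (LOne μ)

/-- Left translation on `L₁(G)`: `(l_t f)(x) = f(t⁻¹ x)`, an isometry. -/
def leftTrans (t : G) : LOne μ →ₗᵢ[ℂ] LOne μ :=
  Lp.compMeasurePreservingₗᵢ ℂ (fun x : G => t⁻¹ * x) (measurePreserving_mul_left μ t⁻¹)

theorem continuous_leftTrans (g : LOne μ) : Continuous fun t : G => leftTrans μ t g := by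
  let F : G → C(G, G) := fun t => ⟨fun x => t⁻¹ * x, by fun_prop⟩
  have hF : Continuous F := by
    apply ContinuousMap.continuous_of_continuous_uncurry
    change Continuous fun p : G × G => p.1⁻¹ * p.2
    fun_prop
  exact Continuous.compMeasurePreservingLp (μ := μ) (ν := μ) (f := fun _ : G => g) (g := F)
    continuous_const hF (fun t => measurePreserving_mul_left μ t⁻¹) ENNReal.one_ne_top

/-- The integrand in the definition of convolution is Bochner integrable. -/
theorem integrable_smul_leftTrans (f g : LOne μ) :
    Integrable (fun s : G => f s • leftTrans μ s g) μ := by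
  have hf : Integrable f μ := L1.integrable_coeFn f
  have hc := continuous_leftTrans μ g
  have hmeas : AEStronglyMeasurable (fun s : G => f s • leftTrans μ s g) μ := by
    have hmem : MemLp f 1 μ := Lp.memLp f
    have hex : ∀ n : ℕ, ∃ h : G → ℂ, eLpNorm (h - (f : G → ℂ)) 1 μ ≤ ((n : ℝ≥0∞) + 1)⁻¹ ∧
        AEStronglyMeasurable h μ ∧
        AEStronglyMeasurable (fun s : G => h s • leftTrans μ s g) μ := by
      intro n
      obtain ⟨h, h1, h2⟩ := hmem.induction_dense ENNReal.one_ne_top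
        (fun h : G → ℂ => AEStronglyMeasurable h μ ∧
          AEStronglyMeasurable (fun s : G => h s • leftTrans μ s g) μ)
        (by
          intro c t ht htμ ε hε
          obtain ⟨η, ηpos, hη⟩ := exists_eLpNorm_indicator_le (μ := μ) ENNReal.one_ne_top c hε
          obtain ⟨K, Kt, Kc, Kcl, hK⟩ := ht.exists_isCompact_isClosed_sdiff_lt htμ.ne
            (ENNReal.coe_pos.2 ηpos).ne'
          refine ⟨K.indicator fun _ => c, ?_,
            aestronglyMeasurable_const.indicator Kcl.measurableSet, ?_⟩
          · rw [← eLpNorm_neg, neg_sub, ← Set.indicator_sdiff Kt]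
            exact hη _ hK.le
          · have : (fun s : G => (K.indicator (fun _ => c) s) • leftTrans μ s g) =
                K.indicator fun s => c • leftTrans μ s g := by
              ext1 s
              by_cases hs : s ∈ K <;> simp [hs]
            rw [this, aestronglyMeasurable_indicator_iff Kcl.measurableSet]
            exact (hc.const_smul c).continuousOn.aestronglyMeasurable_of_isCompact Kc
              Kcl.measurableSet)
        (by
          rintro h k ⟨h1, h2⟩ ⟨k1, k2⟩
          exact ⟨h1.add k1, (h2.add k2).congr
            (Eventually.of_forall fun s => (add_smul (h s) (k s) _).symm)⟩)
        (fun h hh => hh.1) (ε := ((n : ℝ≥0∞) + 1)⁻¹) (ENNReal.inv_ne_zero.2 (by finiteness))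
      refine ⟨h, ?_, h2⟩
      rw [eLpNorm_sub_comm]
      exact h1
    choose h hle hm hFm using hex
    have hlim : Tendsto (fun n => eLpNorm (h n - (f : G → ℂ)) 1 μ) atTop (𝓝 0) := by
      have hz : Tendsto (fun n : ℕ => ((n : ℝ≥0∞) + 1)⁻¹) atTop (𝓝 0) := by
        have := (tendsto_add_atTop_iff_nat 1).2 ENNReal.tendsto_inv_nat_nhds_zero
        simpa using this
      exact tendsto_of_tendsto_of_tendsto_of_le_of_le tendsto_const_nhds hz
        (fun _ => zero_le) hle
    obtain ⟨ns, -, hns⟩ := (tendstoInMeasure_of_tendsto_eLpNorm one_ne_zero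
      hm hmem.1 hlim).exists_seq_tendsto_ae
    refine aestronglyMeasurable_of_tendsto_ae atTop
      (f := fun (n : ℕ) (s : G) => h (ns n) s • leftTrans μ s g) (fun n => hFm (ns n)) ?_
    filter_upwards [hns] with s hs
    exact hs.smul_const _
  refine (hf.norm.mul_const ‖g‖).mono' hmeas (Eventually.of_forall fun s => ?_)
  rw [norm_smul, LinearIsometry.norm_map]

/-- Convolution on `L₁(G)`, as a bounded bilinear map: `f * g = ∫ f(s) l_s g ds`, a Bochner integral
in `L₁(G)`; that is, `(f * g)(x) = ∫ f(s) g(s⁻¹ x) ds` for almost every `x`. -/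
def conv : LOne μ →L[ℂ] LOne μ →L[ℂ] LOne μ :=
  LinearMap.mkContinuous₂
    (LinearMap.mk₂ ℂ (fun f g : LOne μ => ∫ s, f s • leftTrans μ s g ∂μ)
      (fun f₁ f₂ g => by
        rw [← integral_add (integrable_smul_leftTrans μ f₁ g) (integrable_smul_leftTrans μ f₂ g)]
        refine integral_congr_ae ?_
        filter_upwards [Lp.coeFn_add f₁ f₂] with s hs
        rw [hs, Pi.add_apply, add_smul])
      (fun c f g => by
        rw [← integral_smul]
        refine integral_congr_ae ?_
        filter_upwards [Lp.coeFn_smul c f] with s hs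
        rw [hs, Pi.smul_apply, smul_assoc])
      (fun f g₁ g₂ => by
        rw [← integral_add (integrable_smul_leftTrans μ f g₁) (integrable_smul_leftTrans μ f g₂)]
        refine integral_congr_ae (Eventually.of_forall fun s => ?_)
        simp only [map_add, smul_add])
      (fun c f g => by
        rw [← integral_smul]
        refine integral_congr_ae (Eventually.of_forall fun s => ?_)
        simp only [map_smul]
        rw [smul_comm]))
    1
    (fun f g => by
      rw [one_mul, LinearMap.mk₂_apply]
      refine (norm_integral_le_integral_norm _).trans (le_of_eq ?_)
      simp only [norm_smul, LinearIsometry.norm_map]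
      rw [integral_mul_const, ← L1.norm_eq_integral_norm])

theorem conv_apply (f g : LOne μ) : conv μ f g = ∫ s, f s • leftTrans μ s g ∂μ := rfl

/-- `P₁(G)`: the nonnegative functions of norm one in `L₁(G)`. -/
def POne : Set (LOne μ) := {f | (∀ᵐ x ∂μ, 0 ≤ f x) ∧ ‖f‖ = 1}

/-- The element `fT` of `L_∞(G)`: `⟨fT, g⟩ = ⟨T, f * g⟩`. -/
def leftAct (f : LOne μ) (T : LInfty μ) : LInfty μ := T.comp (conv μ f)

/-- The element `Tf` of `L_∞(G)`: `⟨Tf, g⟩ = ⟨T, g * f⟩`. -/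
def rightAct (T : LInfty μ) (f : LOne μ) : LInfty μ := T.comp ((conv μ).flip f)

/-- Left translation on `L_∞(G)`: `(l_t T)(x) = T(t⁻¹ x)`, that is, `⟨l_t T, g⟩ = ⟨T, l_{t⁻¹} g⟩`. -/
def leftTransInfty (t : G) (T : LInfty μ) : LInfty μ :=
  T.comp (leftTrans μ t⁻¹).toContinuousLinearMap

/-- The constant function `1` in `L_∞(G)`: `⟨1, g⟩ = ∫ g(x) dx`. -/
def oneInfty : LInfty μ := L1.integralCLM' ℂ

/-- `T ≥ 0` in `L_∞(G)`: `⟨T, g⟩ ≥ 0` for all `g ≥ 0` in `L₁(G)`. -/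
def NonnegInfty (T : LInfty μ) : Prop := ∀ g : LOne μ, (∀ᵐ x ∂μ, 0 ≤ g x) → 0 ≤ T g

/-- The means (states) on `L_∞(G)`: the positive unital functionals. -/
def Means : Set (StrongDual ℂ (LInfty μ)) :=
  {m | (∀ T : LInfty μ, NonnegInfty μ T → 0 ≤ m T) ∧ m (oneInfty μ) = 1}

/-- `G` is amenable: there is a left-invariant mean on `L_∞(G)`. -/
def IsAmenable : Prop :=
  ∃ m ∈ Means μ, ∀ (t : G) (T : LInfty μ), m (leftTransInfty μ t T) = m T

/-- The topologically left-invariant means on `L_∞(G)`. -/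
def TLIM : Set (StrongDual ℂ (LInfty μ)) :=
  {m | m ∈ Means μ ∧ ∀ f ∈ POne μ, ∀ T : LInfty μ, m (leftAct μ f T) = m T}

/-- The topologically right-invariant means on `L_∞(G)`. -/
def TRIM : Set (StrongDual ℂ (LInfty μ)) :=
  {m | m ∈ Means μ ∧ ∀ f ∈ POne μ, ∀ T : LInfty μ, m (rightAct μ T f) = m T}

/-- The topologically two-sided invariant means on `L_∞(G)`. -/
def TIM : Set (StrongDual ℂ (LInfty μ)) := TLIM μ ∩ TRIM μ

end TopInvMean

end

/-!
The proof produces an open set `E ⊆ G` and a topologically left invariant mean `m` such that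
`m(1_E) = 1`, while `E` is disjoint from `E x`. A two-sided invariant mean gives `E` and `E x` the
same value, and the two values add up to at most `1`; so `m` is not topologically right invariant.

*The set.* `E` is *thick*: every compact `K` has a right translate `K t` inside `E`. Suppose first
that `G` is the union of an increasing sequence of compact sets `Kₙ`, and let `E = ⋃ Kₙ tₙ`, up to
interiors. The sets `Kₙ tₙ` and `Kₙ tₙ x` are disjoint if `tₙ x tₙ⁻¹ ∉ Kₙ⁻¹ Kₙ`, and `Kₙ tₙ` misses
the finitely many earlier translates if `tₙ` avoids a compact set. Both can be achieved since the
conjugacy class of `x` is not precompact (`exists_notMem_conj_notMem`). In general, the `Kₙ` are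
constructed along with the `tₙ`, each containing the earlier `t`'s, so that their union is an open
subgroup `H` containing `x` (`exists_openSubgroup_thick`), and `E` is then copied to all left cosets
of `H` (`exists_isOpen_thick`). Compact sets meet only finitely many cosets, so thickness survives,
and right multiplication by `x ∈ H` preserves each coset, so disjointness does too.

*The mean.* If `m₀` is a left invariant mean and `e` a density, then `T ↦ m₀(eT)` is topologically
left invariant. The reason is that `m₀(fT)` depends on `f` only through `∫ f` (`map_leftAct_eq`):
if `k` is continuous with compact support, the translates of `F = kT` depend continuously on the
translating element in norm, so that `fF` is a norm convergent average of translates of `F` and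
`m₀((k * f)T) = m₀(f(kT)) = (∫ f) m₀(kT)`; then density of such `k` and an approximate unit apply.
Given a topologically left invariant mean, separation of convex sets provides densities `f` for
which `‖a * f - f‖₁` is small for finitely many prescribed densities `a`
(`exists_almost_invariant`). Convolving `f` on the right does not spoil this, and by thickness a
right convolution moves almost all mass of `f` into `E` (`exists_setInfty_conv_close`). A weak-*
limit along an ultrafilter is the mean `m` (`exists_mem_TLIM_setInfty_eq_one`).

*Right invariance fails.* As `m` is only tested against convolutions, the translation by `x` is
encoded by comparing the normalized indicator functions of `A` and `A x⁻¹`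
(`notMem_TRIM_of_setInfty_eq_one`).
-/

set_option linter.unusedSectionVars false

noncomputable section

namespace TopInvMean

/-! ### A thick open set disjoint from its right translate -/

section Thick

open scoped Pointwise

variable {G : Type*} [Group G] [TopologicalSpace G] [IsTopologicalGroup G]

/-- If the conjugacy class of `x` were caught by `M` whenever the conjugating element lies outside
`M`, the class would lie in the compact set `M ∪ M x M⁻¹`. -/
theorem exists_notMem_conj_notMem [T2Space G] {x : G}
    (hx : ¬ IsCompact (closure (Set.range fun g : G => g * x * g⁻¹))) {M : Set G}
    (hM : IsCompact M) : ∃ t : G, t ∉ M ∧ t * x * t⁻¹ ∉ M := by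
  by_contra! h
  have hc : IsCompact (M ∪ M * {x} * M⁻¹) := hM.union ((hM.mul isCompact_singleton).mul hM.inv)
  refine hx (hc.of_isClosed_subset isClosed_closure (closure_minimal ?_ hc.isClosed))
  rintro _ ⟨g, rfl⟩
  by_cases hg : g ∈ M
  · exact Or.inr (Set.mul_mem_mul (Set.mul_mem_mul hg rfl) (Set.inv_mem_inv.2 hg))
  · exact Or.inl (h g hg)

/-- The σ-compact part of the construction: an open subgroup `H` containing `x` and an open set
`E` containing a right translate `K t`, `t ∈ H`, of each compact subset `K` of `H`, such that
`E` and `E x⁻¹` are disjoint. -/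
theorem exists_openSubgroup_thick [T2Space G] [LocallyCompactSpace G] {x : G}
    (hx : ¬ IsCompact (closure (Set.range fun g : G => g * x * g⁻¹))) :
    ∃ (H : Subgroup G) (E : Set G), IsOpen (H : Set G) ∧ x ∈ H ∧ IsOpen E ∧
      (∀ K ⊆ (H : Set G), IsCompact K → ∃ t ∈ H, ∀ k ∈ K, k * t ∈ E) ∧
      ∀ y ∈ E, y * x ∉ E := by
  -- The element chosen for a non-compact `L` is irrelevant.
  have hch : ∀ L : Set G, ∃ t : G, IsCompact L → t ∉ L⁻¹ * L ∧ t * x * t⁻¹ ∉ L⁻¹ * L := by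
    intro L
    by_cases hL : IsCompact L
    · obtain ⟨t, ht⟩ := exists_notMem_conj_notMem hx (hL.inv.mul hL)
      exact ⟨t, fun _ => ht⟩
    · exact ⟨1, fun h => absurd h hL⟩
  choose t ht using hch
  obtain ⟨N, hNc, hN⟩ := exists_compact_mem_nhds (1 : G)
  -- Each `K (n + 1)` contains all products of three factors from `K n`, its inverses and `t (K n)`.
  let B : Set G → Set G := fun L => L ∪ L⁻¹ ∪ {t L}
  let K : ℕ → Set G := fun n => Nat.rec (N ∪ {x}) (fun _ L => B L * B L * B L) n
  have hK0 : K 0 = N ∪ {x} := rfl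
  have hKs : ∀ n, K (n + 1) = B (K n) * B (K n) * B (K n) := fun n => rfl
  have hLB : ∀ n, K n ⊆ B (K n) := fun n y hy => Or.inl (Or.inl hy)
  have hIB : ∀ n, (K n)⁻¹ ⊆ B (K n) := fun n y hy => Or.inl (Or.inr hy)
  have htB : ∀ n, t (K n) ∈ B (K n) := fun n => Or.inr rfl
  have key : ∀ n a b c, a ∈ B (K n) → b ∈ B (K n) → c ∈ B (K n) → a * b * c ∈ K (n + 1) :=
    fun n a b c ha hb hc => Set.mul_mem_mul (Set.mul_mem_mul ha hb) hc
  have hone : ∀ n, (1 : G) ∈ K n := by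
    intro n
    induction n with
    | zero => exact Or.inl (mem_of_mem_nhds hN)
    | succ n ih => simpa using key n 1 1 1 (hLB n ih) (hLB n ih) (hLB n ih)
  have hBs : ∀ n, B (K n) ⊆ K (n + 1) := fun n a ha => by
    simpa using key n a 1 1 ha (hLB n (hone n)) (hLB n (hone n))
  have hmono : Monotone K := monotone_nat_of_le_succ fun n => (hLB n).trans (hBs n)
  have hcpt : ∀ n, IsCompact (K n) := by
    intro n
    induction n with
    | zero => exact hNc.union isCompact_singleton
    | succ n ih =>
      have hB : IsCompact (B (K n)) := (ih.union ih.inv).union isCompact_singleton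
      exact (hB.mul hB).mul hB
  have hxK : ∀ n, x ∈ K n := fun n => hmono (Nat.zero_le n) (Or.inr rfl)
  have hint : ∀ n, K n ⊆ interior (K (n + 1)) := by
    intro n y hy
    rw [mem_interior_iff_mem_nhds]
    have h1 : y • N ∈ 𝓝 y := by simpa using smul_mem_nhds_smul y hN
    refine mem_of_superset h1 ?_
    rintro _ ⟨z, hz, rfl⟩
    have hz' : z ∈ K n := hmono (Nat.zero_le n) (Or.inl hz)
    simpa using key n y z 1 (hLB n hy) (hLB n hz') (hLB n (hone n))
  let H : Subgroup G :=
    { carrier := ⋃ n, K n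
      mul_mem' := by
        intro a b ha hb
        obtain ⟨n, hn⟩ := Set.mem_iUnion.1 ha
        obtain ⟨m, hm⟩ := Set.mem_iUnion.1 hb
        refine Set.mem_iUnion.2 ⟨max n m + 1, ?_⟩
        simpa using key (max n m) a b 1 (hLB _ (hmono (le_max_left n m) hn))
          (hLB _ (hmono (le_max_right n m) hm)) (hLB _ (hone _))
      one_mem' := Set.mem_iUnion.2 ⟨0, hone 0⟩
      inv_mem' := by
        intro a ha
        obtain ⟨n, hn⟩ := Set.mem_iUnion.1 ha
        exact Set.mem_iUnion.2 ⟨n + 1, hBs n (hIB n (Set.inv_mem_inv.2 hn))⟩ }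
  have hH : ∀ y, y ∈ H ↔ ∃ n, y ∈ K n := fun y => Set.mem_iUnion
  have hHint : (H : Set G) = ⋃ n, interior (K n) := by
    ext y
    rw [SetLike.mem_coe, hH, Set.mem_iUnion]
    exact ⟨fun ⟨n, hn⟩ => ⟨n + 1, hint n hn⟩, fun ⟨n, hn⟩ => ⟨n, interior_subset hn⟩⟩
  -- The set `⋃ₙ Kₙ tₙ`, with `Kₙ` replaced by its interior to make it open.
  refine ⟨H, ⋃ n, (fun y => y * (t (K n))⁻¹) ⁻¹' interior (K n), ?_, (hH x).2 ⟨0, hxK 0⟩,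
    isOpen_iUnion fun n => isOpen_interior.preimage (by fun_prop), ?_, ?_⟩
  · rw [hHint]
    exact isOpen_iUnion fun n => isOpen_interior
  · intro C hCH hC
    rw [hHint] at hCH
    obtain ⟨n, hn⟩ := hC.elim_directed_cover _ (fun n => isOpen_interior) hCH
      (directed_of_isDirected_le fun a b hab => interior_mono (hmono hab))
    refine ⟨t (K n), (hH _).2 ⟨n + 1, hBs n (htB n)⟩, fun k hk => Set.mem_iUnion.2 ⟨n, ?_⟩⟩
    simpa using hn hk
  · intro y hy hyx
    obtain ⟨n, hn⟩ := Set.mem_iUnion.1 hy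
    obtain ⟨m, hm⟩ := Set.mem_iUnion.1 hyx
    replace hn := interior_subset hn
    replace hm := interior_subset hm
    rcases lt_trichotomy n m with h | rfl | h
    · -- `K n t n x ⊆ K (n + 1) ⊆ K m`, while `t m ∉ (K m)⁻¹ K m`.
      have h1 : y * x ∈ K m := by
        have := key n _ _ _ (hLB n hn) (htB n) (hLB n (hxK n))
        rw [inv_mul_cancel_right] at this
        exact hmono h this
      refine (ht (K m) (hcpt m)).1 ?_
      convert Set.mul_mem_mul (Set.inv_mem_inv.2 hm) h1 using 1
      group
    · refine (ht (K n) (hcpt n)).2 ?_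
      convert Set.mul_mem_mul (Set.inv_mem_inv.2 hn) hm using 1
      group
    · have h1 : y ∈ K n := by
        have := key m _ _ _ (hLB m hm) (htB m) (hIB m (Set.inv_mem_inv.2 (hxK m)))
        rw [inv_mul_cancel_right, mul_inv_cancel_right] at this
        exact hmono h this
      refine (ht (K n) (hcpt n)).1 ?_
      convert Set.mul_mem_mul (Set.inv_mem_inv.2 hn) h1 using 1
      group

/-- Passage from the open subgroup `H` to `G`: translate the thick subset of `H` to every left coset
of `H` by a coset representative. -/
theorem exists_isOpen_thick [T2Space G] [LocallyCompactSpace G] {x : G}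
    (hx : ¬ IsCompact (closure (Set.range fun g : G => g * x * g⁻¹))) :
    ∃ E : Set G, IsOpen E ∧ (∀ K : Set G, IsCompact K → ∃ t, ∀ k ∈ K, k * t ∈ E) ∧
      ∀ y ∈ E, y * x ∉ E := by
  obtain ⟨H, E, hH, hxH, hE, hthick, hdisj⟩ := exists_openSubgroup_thick hx
  have : DiscreteTopology (G ⧸ H) := QuotientGroup.discreteTopology hH
  let r : G → G := fun y => (QuotientGroup.mk y : G ⧸ H).out
  have hr : Continuous r :=
    (continuous_of_discreteTopology (f := fun q : G ⧸ H => q.out)).comp continuous_quotient_mk'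
  have hrmul : ∀ y, ∀ h ∈ H, r (y * h) = r y := by
    intro y h hh
    have : (QuotientGroup.mk (y * h) : G ⧸ H) = QuotientGroup.mk y := by
      rw [eq_comm, QuotientGroup.eq]
      simpa using hh
    simp only [r, this]
  have hrH : ∀ y, (r y)⁻¹ * y ∈ H := fun y => by
    rw [← QuotientGroup.eq]
    exact Quotient.out_eq _
  have hc : Continuous fun y => (r y)⁻¹ * y := hr.inv.mul continuous_id
  refine ⟨(fun y => (r y)⁻¹ * y) ⁻¹' E, hE.preimage hc, ?_, ?_⟩
  · intro K hK
    obtain ⟨t, htH, ht⟩ := hthick ((fun y => (r y)⁻¹ * y) '' K)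
      (by rintro _ ⟨y, -, rfl⟩; exact hrH y) (hK.image hc)
    refine ⟨t, fun k hk => ?_⟩
    rw [Set.mem_preimage, hrmul k t htH, ← mul_assoc]
    exact ht _ ⟨k, hk, rfl⟩
  · intro y hy hyx
    rw [Set.mem_preimage] at hy hyx
    rw [hrmul y x hxH, ← mul_assoc] at hyx
    exact hdisj _ hy hyx

end Thick

variable {G : Type*} [Group G] [TopologicalSpace G] [IsTopologicalGroup G]
  [LocallyCompactSpace G] [MeasurableSpace G] [BorelSpace G]
  (μ : Measure G) [μ.IsHaarMeasure] [μ.Regular]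

open scoped ENNReal ComplexOrder Pointwise

/-! ### Convolution on `L₁(G)` -/

theorem leftTrans_coeFn (t : G) (g : LOne μ) :
    (leftTrans μ t g : G → ℂ) =ᵐ[μ] fun y => g (t⁻¹ * y) :=
  Lp.coeFn_compMeasurePreserving g (measurePreserving_mul_left μ t⁻¹)

theorem leftTrans_mul (s t : G) (g : LOne μ) :
    leftTrans μ (s * t) g = leftTrans μ s (leftTrans μ t g) := by
  apply Lp.ext
  have h1 := (measurePreserving_mul_left μ s⁻¹).quasiMeasurePreserving.ae_eq_comp
    (leftTrans_coeFn μ t g)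
  filter_upwards [leftTrans_coeFn μ (s * t) g, leftTrans_coeFn μ s (leftTrans μ t g), h1]
    with y hy1 hy2 hy3
  simp only [Function.comp_apply] at hy3
  rw [hy1, hy2, hy3, mul_inv_rev, mul_assoc]

theorem leftTrans_one (g : LOne μ) : leftTrans μ 1 g = g := by
  apply Lp.ext
  filter_upwards [leftTrans_coeFn μ 1 g] with y hy
  rw [hy, inv_one, one_mul]

theorem leftTrans_nonneg (t : G) {g : LOne μ} (hg : ∀ᵐ y ∂μ, 0 ≤ g y) :
    ∀ᵐ y ∂μ, 0 ≤ leftTrans μ t g y := by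
  have h1 := (measurePreserving_mul_left μ t⁻¹).quasiMeasurePreserving.ae hg
  filter_upwards [leftTrans_coeFn μ t g, h1] with y hy1 hy2
  rw [hy1]
  exact hy2

theorem oneInfty_apply (f : LOne μ) : oneInfty μ f = ∫ y, f y ∂μ := by
  rw [oneInfty, ← L1.integral_eq', L1.integral_eq_integral]

theorem oneInfty_leftTrans (t : G) (g : LOne μ) :
    oneInfty μ (leftTrans μ t g) = oneInfty μ g := by
  rw [oneInfty_apply, oneInfty_apply, integral_congr_ae (leftTrans_coeFn μ t g)]
  exact integral_mul_left_eq_self (fun y => g y) t⁻¹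

theorem integrable_mul_apply_leftTrans (f g : LOne μ) (T : LInfty μ) :
    Integrable (fun s => f s * T (leftTrans μ s g)) μ := by
  have := T.integrable_comp (integrable_smul_leftTrans μ f g)
  simpa only [map_smul, smul_eq_mul] using this

theorem apply_conv (f g : LOne μ) (T : LInfty μ) :
    T (conv μ f g) = ∫ s, f s * T (leftTrans μ s g) ∂μ := by
  rw [conv_apply, ← T.integral_comp_comm (integrable_smul_leftTrans μ f g)]
  simp only [map_smul, smul_eq_mul]

theorem oneInfty_conv (f g : LOne μ) :
    oneInfty μ (conv μ f g) = oneInfty μ f * oneInfty μ g := by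
  rw [apply_conv]
  simp only [oneInfty_leftTrans]
  rw [integral_mul_const, ← oneInfty_apply]

theorem leftTrans_conv (t : G) (f g : LOne μ) :
    leftTrans μ t (conv μ f g) = conv μ (leftTrans μ t f) g := by
  rw [conv_apply, conv_apply]
  have h1 := (leftTrans μ t).toContinuousLinearMap.integral_comp_comm
    (integrable_smul_leftTrans μ f g)
  simp only [LinearIsometry.coe_toContinuousLinearMap, map_smul, ← leftTrans_mul] at h1
  rw [← h1, ← integral_mul_left_eq_self _ t⁻¹]
  refine integral_congr_ae ?_
  filter_upwards [leftTrans_coeFn μ t f] with s hs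
  rw [hs, mul_inv_cancel_left]

theorem conv_assoc (f g h : LOne μ) : conv μ (conv μ f g) h = conv μ f (conv μ g h) := by
  have h1 := ((conv μ).flip h).integral_comp_comm (integrable_smul_leftTrans μ f g)
  simp only [map_smul, ContinuousLinearMap.flip_apply, ← conv_apply] at h1
  rw [← h1, conv_apply μ f (conv μ g h)]
  simp only [leftTrans_conv]

theorem norm_conv_le (f g : LOne μ) : ‖conv μ f g‖ ≤ ‖f‖ * ‖g‖ := by
  rw [conv_apply]
  refine (norm_integral_le_integral_norm _).trans (le_of_eq ?_)
  simp only [norm_smul, LinearIsometry.norm_map]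
  rw [integral_mul_const, ← L1.norm_eq_integral_norm]

theorem NonnegInfty.apply_conv_nonneg {T : LInfty μ} (hT : NonnegInfty μ T) {f g : LOne μ}
    (hf : ∀ᵐ y ∂μ, 0 ≤ f y) (hg : ∀ᵐ y ∂μ, 0 ≤ g y) : 0 ≤ T (conv μ f g) := by
  rw [apply_conv]
  refine integral_nonneg_of_ae ?_
  filter_upwards [hf] with s hs
  exact mul_nonneg hs (hT _ (leftTrans_nonneg μ s hg))

theorem oneInfty_eq_norm {f : LOne μ} (hf : ∀ᵐ y ∂μ, 0 ≤ f y) : oneInfty μ f = ‖f‖ := by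
  rw [oneInfty_apply, L1.norm_eq_integral_norm, ← integral_complex_ofReal]
  refine integral_congr_ae ?_
  filter_upwards [hf] with y hy
  exact Complex.eq_coe_norm_of_nonneg hy

theorem mem_POne_iff (f : LOne μ) :
    f ∈ POne μ ↔ (∀ᵐ y ∂μ, 0 ≤ f y) ∧ oneInfty μ f = 1 := by
  refine and_congr_right fun hf => ?_
  rw [oneInfty_eq_norm μ hf]
  norm_cast

theorem leftAct_leftAct (f g : LOne μ) (T : LInfty μ) :
    leftAct μ g (leftAct μ f T) = leftAct μ (conv μ f g) T := by
  ext h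
  simp only [leftAct, ContinuousLinearMap.comp_apply, conv_assoc]

theorem leftAct_oneInfty {f : LOne μ} (hf : f ∈ POne μ) :
    leftAct μ f (oneInfty μ) = oneInfty μ := by
  ext h
  simp [leftAct, oneInfty_conv, ((mem_POne_iff μ f).1 hf).2]

theorem convex_POne : Convex ℝ (POne μ) := by
  intro f hf g hg a b ha hb hab
  rw [mem_POne_iff] at hf hg ⊢
  constructor
  · filter_upwards [hf.1, hg.1, Lp.coeFn_add (a • f) (b • g), Lp.coeFn_smul a f,
      Lp.coeFn_smul b g] with y h1 h2 h3 h4 h5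
    rw [h3, Pi.add_apply, h4, h5, Pi.smul_apply, Pi.smul_apply]
    exact add_nonneg (smul_nonneg ha h1) (smul_nonneg hb h2)
  · rw [map_add, (oneInfty μ).map_smul_of_tower, (oneInfty μ).map_smul_of_tower, hf.2, hg.2]
    rw [Complex.real_smul, Complex.real_smul, mul_one, mul_one]
    exact_mod_cast hab

/-! ### Density of compactly supported functions and approximate units -/

/-- Compactly supported continuous functions are dense in `ℒ₁`. The corresponding statement in
Mathlib assumes a normal space; Urysohn's lemma for compact sets suffices here. -/
theorem exists_hasCompactSupport_eLpNorm_one_sub_le {f : G → ℂ} (hf : MemLp f 1 μ) {ε : ℝ≥0∞}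
    (hε : ε ≠ 0) :
    ∃ g : G → ℂ, eLpNorm (f - g) 1 μ ≤ ε ∧ Continuous g ∧ HasCompactSupport g := by
  have hadd : ∀ f g : G → ℂ, (Continuous f ∧ HasCompactSupport f) →
      (Continuous g ∧ HasCompactSupport g) → Continuous (f + g) ∧ HasCompactSupport (f + g) :=
    fun f g hf hg => ⟨hf.1.add hg.1, hf.2.add hg.2⟩
  have hmeas : ∀ f : G → ℂ, (Continuous f ∧ HasCompactSupport f) → AEStronglyMeasurable f μ :=
    fun f hf => (hf.1.integrable_of_hasCompactSupport hf.2).aestronglyMeasurable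
  refine hf.induction_dense ENNReal.one_ne_top (fun g => Continuous g ∧ HasCompactSupport g) ?_
    hadd hmeas hε
  intro c t ht htμ ε hε
  have hε2 : ε / 2 ≠ 0 := (ENNReal.half_pos hε).ne'
  obtain ⟨η, ηpos, hη⟩ := exists_eLpNorm_indicator_le (μ := μ) ENNReal.one_ne_top c hε2
  have hη0 : (η : ℝ≥0∞) ≠ 0 := (ENNReal.coe_pos.2 ηpos).ne'
  obtain ⟨K, Kt, Kc, Kcl, hK⟩ := ht.exists_isCompact_isClosed_sdiff_lt htμ.ne hη0
  have hKμ : μ K ≠ ∞ := Kc.measure_lt_top.ne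
  obtain ⟨U, KU, Uo, hU⟩ := K.exists_isOpen_lt_add hKμ hη0
  obtain ⟨φ, hφK, hφU, hφs, hφ⟩ := exists_continuous_one_zero_of_isCompact Kc Uo.isClosed_compl
    (Set.disjoint_compl_right_iff_subset.2 KU)
  have hUK : μ (U \ K) ≤ η := by
    rw [measure_sdiff KU Kcl.measurableSet.nullMeasurableSet hKμ]
    exact tsub_le_iff_left.2 hU.le
  refine ⟨fun y => φ y • c, ?_, by fun_prop, hφs.smul_right⟩
  have hKm : AEStronglyMeasurable (K.indicator fun _ => c) μ :=
    aestronglyMeasurable_const.indicator Kcl.measurableSet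
  have h1 : eLpNorm ((fun y => φ y • c) - K.indicator fun _ => c) 1 μ ≤ ε / 2 := by
    refine (eLpNorm_mono fun y => ?_).trans (hη _ hUK)
    by_cases hyK : y ∈ K
    · simp [hyK, hφK hyK]
    · by_cases hyU : y ∈ U
      · have : ‖φ y‖ ≤ 1 := by rw [Real.norm_of_nonneg (hφ y).1]; exact (hφ y).2
        simpa [hyK, hyU, norm_smul] using mul_le_of_le_one_left (norm_nonneg c) this
      · simp [hyK, hyU, hφU hyU]
  have h2 : eLpNorm ((K.indicator fun _ => c) - t.indicator fun _ => c) 1 μ ≤ ε / 2 := by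
    rw [← eLpNorm_neg, neg_sub, ← Set.indicator_sdiff Kt]
    exact hη _ hK.le
  calc _ = eLpNorm (((fun y => φ y • c) - K.indicator fun _ => c) +
        ((K.indicator fun _ => c) - t.indicator fun _ => c)) 1 μ := by rw [sub_add_sub_cancel]
    _ ≤ ε / 2 + ε / 2 := (eLpNorm_add_le (by fun_prop)
        (hKm.sub (aestronglyMeasurable_const.indicator ht)) le_rfl).trans (add_le_add h1 h2)
    _ = ε := ENNReal.add_halves ε

theorem LInfty.ext_of_hasCompactSupport {A B : LInfty μ}
    (h : ∀ (k : G → ℂ) (_ : Continuous k) (_ : HasCompactSupport k) (hk : MemLp k 1 μ),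
      A (hk.toLp k) = B (hk.toLp k)) : A = B := by
  ext f
  have hcl : IsClosed {f : LOne μ | A f = B f} := isClosed_eq A.continuous B.continuous
  change f ∈ {f : LOne μ | A f = B f}
  rw [← hcl.closure_eq, EMetric.mem_closure_iff]
  intro ε hε
  obtain ⟨δ, hδ, hδε⟩ := exists_between hε
  obtain ⟨k, hkd, hkc, hks⟩ :=
    exists_hasCompactSupport_eLpNorm_one_sub_le μ (Lp.memLp f) hδ.ne'
  have hk : MemLp k 1 μ := memLp_one_iff_integrable.2 (hkc.integrable_of_hasCompactSupport hks)
  refine ⟨hk.toLp k, h k hkc hks hk, lt_of_le_of_lt ?_ hδε⟩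
  rw [Lp.edist_def]
  refine le_trans (le_of_eq (eLpNorm_congr_ae ?_)) hkd
  filter_upwards [hk.coeFn_toLp] with y hy
  rw [Pi.sub_apply, Pi.sub_apply, hy]

/-- The indicator function of `A`, normalized to have integral one. -/
def normIndicator (A : Set G) (hA : MeasurableSet A) (hA' : μ A ≠ ∞) : LOne μ :=
  indicatorConstLp 1 hA hA' (((μ.real A)⁻¹ : ℝ) : ℂ)

theorem normIndicator_coeFn (A : Set G) (hA : MeasurableSet A) (hA' : μ A ≠ ∞) :
    (normIndicator μ A hA hA' : G → ℂ) =ᵐ[μ] A.indicator fun _ => (((μ.real A)⁻¹ : ℝ) : ℂ) :=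
  indicatorConstLp_coeFn

theorem normIndicator_mem_POne (A : Set G) (hA : MeasurableSet A) (hA' : μ A ≠ ∞)
    (hA0 : μ A ≠ 0) : normIndicator μ A hA hA' ∈ POne μ := by
  constructor
  · filter_upwards [normIndicator_coeFn μ A hA hA'] with y hy
    rw [hy]
    refine Set.indicator_nonneg (fun _ _ => ?_) y
    exact_mod_cast inv_nonneg.2 measureReal_nonneg
  · have h : μ.real A ≠ 0 := (ENNReal.toReal_pos hA0 hA').ne'
    rw [normIndicator, norm_indicatorConstLp one_ne_zero ENNReal.one_ne_top, Complex.norm_real,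
      norm_inv, Real.norm_of_nonneg measureReal_nonneg]
    simp [h]

theorem exists_mem_POne_supported {t : G} {V : Set G} (hV : V ∈ 𝓝 t) :
    ∃ h ∈ POne μ, ∀ᵐ y ∂μ, y ∉ V → h y = 0 := by
  obtain ⟨K, hK, hKV, hKc⟩ := local_compact_nhds hV
  have hne : (interior K).Nonempty := ⟨t, mem_interior_iff_mem_nhds.2 hK⟩
  have hfin : μ (interior K) ≠ ∞ := ((measure_mono interior_subset).trans_lt hKc.measure_lt_top).ne
  refine ⟨_, normIndicator_mem_POne μ _ isOpen_interior.measurableSet hfin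
    (isOpen_interior.measure_pos μ hne).ne', ?_⟩
  filter_upwards [normIndicator_coeFn μ _ isOpen_interior.measurableSet hfin] with y hy hyV
  rw [hy]
  exact Set.indicator_of_notMem (fun h => hyV (hKV (interior_subset h))) _

theorem norm_conv_sub_le {h f : LOne μ} (hh : h ∈ POne μ) {V : Set G} {ε : ℝ}
    (hV : ∀ᵐ y ∂μ, y ∉ V → h y = 0) (hf : ∀ s ∈ V, ‖leftTrans μ s f - f‖ ≤ ε) :
    ‖conv μ h f - f‖ ≤ ε := by
  have h1 : ∫ s, h s • f ∂μ = f := by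
    rw [integral_smul_const, ← oneInfty_apply, ((mem_POne_iff μ h).1 hh).2, one_smul]
  have h2 : Integrable (fun s => h s • f) μ := (L1.integrable_coeFn h).smul_const f
  have h3 : conv μ h f - f = ∫ s, h s • (leftTrans μ s f - f) ∂μ := by
    simp only [smul_sub]
    rw [integral_sub (integrable_smul_leftTrans μ h f) h2, h1, conv_apply]
  rw [h3]
  calc _ ≤ ∫ s, ‖h s‖ * ε ∂μ := by
        refine norm_integral_le_of_norm_le ((L1.integrable_coeFn h).norm.mul_const ε) ?_
        filter_upwards [hV] with s hs
        rw [norm_smul]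
        by_cases hsV : s ∈ V
        · exact mul_le_mul_of_nonneg_left (hf s hsV) (norm_nonneg _)
        · simp [hs hsV]
    _ = ε := by rw [integral_mul_const, ← L1.norm_eq_integral_norm, hh.2, one_mul]

/-- Approximate units: convolving on the left by a density concentrated near `1` moves two given
functions by at most `ε`. -/
theorem exists_mem_POne_norm_conv_sub_le (f g : LOne μ) {ε : ℝ} (hε : 0 < ε) :
    ∃ h ∈ POne μ, ‖conv μ h f - f‖ ≤ ε ∧ ‖conv μ h g - g‖ ≤ ε := by
  have hc : ∀ f : LOne μ, ∀ᶠ s in 𝓝 (1 : G), ‖leftTrans μ s f - f‖ ≤ ε := by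
    intro f
    have : Tendsto (fun s => ‖leftTrans μ s f - f‖) (𝓝 1) (𝓝 ‖leftTrans μ 1 f - f‖) :=
      ((continuous_leftTrans μ f).sub continuous_const).norm.tendsto 1
    rw [leftTrans_one, sub_self, norm_zero] at this
    exact this.eventually (eventually_le_nhds hε)
  obtain ⟨h, hh, hV⟩ := exists_mem_POne_supported μ ((hc f).and (hc g))
  exact ⟨h, hh, norm_conv_sub_le μ hh hV fun s hs => hs.1,
    norm_conv_sub_le μ hh hV fun s hs => hs.2⟩

/-! ### Norm continuity of translation orbits -/

theorem continuous_integral_of_locally_compact_support {X E : Type*} [TopologicalSpace X]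
    [NormedAddCommGroup E] [NormedSpace ℝ E] {F : X → G → E}
    (hF : Continuous (Function.uncurry F))
    (hs : ∀ s, ∃ L ∈ 𝓝 s, ∃ C, IsCompact C ∧ ∀ u ∈ L, ∀ v ∉ C, F u v = 0) :
    Continuous fun s => ∫ v, F s v ∂μ := by
  refine continuous_iff_continuousAt.2 fun s => ?_
  obtain ⟨L, hL, C, hC, hLC⟩ := hs s
  exact (continuousOn_integral_of_compact_support hC hF.continuousOn
    fun u v hu hv => hLC u hu v hv).continuousAt hL

open Measure in
/-- For a regular Haar measure, right translation scales the measure by the modular character. -/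
theorem map_mul_right_eq_modularCharacterFun_smul (s : G) :
    μ.map (· * s) = modularCharacterFun s • μ := by
  have : (μ.map (· * s)).Regular := Regular.map (Homeomorph.mulRight s)
  rw [modularCharacterFun_eq_haarScalarFactor μ]
  exact isMulLeftInvariant_eq_smul_of_regular _ μ

open Measure in
theorem integral_mul_right_eq_modularCharacterFun_smul {E : Type*} [NormedAddCommGroup E]
    [NormedSpace ℝ E] (F : G → E) (s : G) :
    ∫ v, F (v * s) ∂μ = (modularCharacterFun s : ℝ) • ∫ v, F v ∂μ := by
  have h := (Homeomorph.mulRight s).measurableEmbedding.integral_map (μ := μ) F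
  change ∫ v, F v ∂(μ.map (· * s)) = ∫ v, F (v * s) ∂μ at h
  rw [← h, map_mul_right_eq_modularCharacterFun_smul, integral_smul_nnreal_measure]
  rfl

open Measure in
theorem continuous_modularCharacterFun :
    Continuous fun s : G => (modularCharacterFun s : ℝ) := by
  borelize G
  let ν : Measure G := haar
  obtain ⟨⟨f, hf⟩, hfs, hf0, hf1⟩ :
    ∃ f : C(G, ℝ), HasCompactSupport f ∧ 0 ≤ (f : G → ℝ) ∧ f 1 ≠ 0 :=
      exists_continuous_nonneg_pos 1
  have hpos : ∫ v, f v ∂ν ≠ 0 :=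
    (hf.integral_pos_of_hasCompactSupport_nonneg_nonzero hfs hf0 hf1).ne'
  have h : (fun s : G => (modularCharacterFun s : ℝ)) =
      fun s => (∫ v, f (v * s) ∂ν) / ∫ v, f v ∂ν := by
    ext s
    rw [integral_mul_right_eq_modularCharacterFun_smul ν f s, smul_eq_mul,
      mul_div_cancel_right₀ _ hpos]
  rw [h]
  refine (continuous_integral_of_locally_compact_support ν (by fun_prop) fun s => ?_).div_const _
  obtain ⟨L, hL, hLs⟩ := exists_compact_mem_nhds s
  refine ⟨L, hLs, tsupport f * L⁻¹, hfs.isCompact.mul hL.inv, fun u hu v hv => ?_⟩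
  by_contra hne
  refine hv ⟨v * u, subset_tsupport f hne, u⁻¹, Set.inv_mem_inv.2 hu, by simp⟩

open Measure in
theorem conv_toLp_leftTrans {k : G → ℂ} (hk : MemLp k 1 μ) (g : LOne μ) (s : G) :
    conv μ (hk.toLp k) (leftTrans μ s g) =
      ∫ v, ((modularCharacterFun s : ℝ) • k (v * s⁻¹)) • leftTrans μ v g ∂μ := by
  have h : conv μ (hk.toLp k) (leftTrans μ s g) =
      ∫ v, k v • leftTrans μ v (leftTrans μ s g) ∂μ := by
    rw [conv_apply]
    refine integral_congr_ae ?_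
    filter_upwards [hk.coeFn_toLp] with v hv
    rw [hv]
  simp only [smul_assoc]
  rw [integral_smul, ← integral_mul_right_eq_modularCharacterFun_smul μ
    (fun v => k (v * s⁻¹) • leftTrans μ v g) s, h]
  simp only [mul_inv_cancel_right, leftTrans_mul]

/-- Moving the translation from the second factor of `k * l_s g` to the first, the distance between
two points of the orbit of `kT` is at most `‖T‖` times the `L₁` distance of two right translates of
`k`, rescaled by the modular character. The latter is an integral of a jointly continuous function
with locally uniform compact support, hence depends continuously on the translating elements. -/
theorem continuous_leftAct_comp_leftTrans {k : G → ℂ} (hk : Continuous k)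
    (hks : HasCompactSupport k) (hk1 : MemLp k 1 μ) (T : LInfty μ) :
    Continuous fun s : G =>
      (leftAct μ (hk1.toLp k) T).comp (leftTrans μ s).toContinuousLinearMap := by
  have hΔ := continuous_modularCharacterFun (G := G)
  set Δ : G → ℝ := fun s => (Measure.modularCharacterFun s : ℝ)
  refine continuous_iff_continuousAt.2 fun s₀ => ?_
  let F : G → G → ℂ := fun s v => Δ s • k (v * s⁻¹) - Δ s₀ • k (v * s₀⁻¹)
  have hFc : Continuous (Function.uncurry F) := by
    change Continuous fun p : G × G => Δ p.1 • k (p.2 * p.1⁻¹) - Δ s₀ • k (p.2 * s₀⁻¹)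
    fun_prop
  have hFs : ∀ s, ∃ L ∈ 𝓝 s, ∃ C, IsCompact C ∧ ∀ u ∈ L, ∀ v ∉ C, F u v = 0 := by
    intro s
    obtain ⟨L, hL, hLs⟩ := exists_compact_mem_nhds s
    refine ⟨L, hLs, tsupport k * L ∪ tsupport k * {s₀}, (hks.isCompact.mul hL).union
      (hks.isCompact.mul isCompact_singleton), fun u hu v hv => ?_⟩
    have h1 : k (v * u⁻¹) = 0 := by
      by_contra hne
      exact hv (Or.inl ⟨v * u⁻¹, subset_tsupport k hne, u, hu, by simp⟩)
    have h2 : k (v * s₀⁻¹) = 0 := by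
      by_contra hne
      exact hv (Or.inr ⟨v * s₀⁻¹, subset_tsupport k hne, s₀, rfl, by simp⟩)
    simp [F, h1, h2]
  have hFi : ∀ s, Integrable (F s) μ := fun s => by
    obtain ⟨L, hL, C, hC, hLC⟩ := hFs s
    refine (hFc.comp (Continuous.prodMk_right s)).integrable_of_hasCompactSupport ?_
    exact HasCompactSupport.intro hC fun v hv => hLC s (mem_of_mem_nhds hL) v hv
  have hD : Continuous fun s => ∫ v, ‖F s v‖ ∂μ :=
    continuous_integral_of_locally_compact_support μ hFc.norm fun s => by
      obtain ⟨L, hL, C, hC, hLC⟩ := hFs s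
      exact ⟨L, hL, C, hC, fun u hu v hv => by rw [hLC u hu v hv, norm_zero]⟩
  have hbound : ∀ s g, ‖conv μ (hk1.toLp k) (leftTrans μ s g) -
      conv μ (hk1.toLp k) (leftTrans μ s₀ g)‖ ≤ (∫ v, ‖F s v‖ ∂μ) * ‖g‖ := by
    intro s g
    have hint : ∀ s, Integrable (fun v => (Δ s • k (v * s⁻¹)) • leftTrans μ v g) μ := by
      intro s
      have hc := continuous_leftTrans μ g
      refine Continuous.integrable_of_hasCompactSupport (by fun_prop)
        (HasCompactSupport.intro (hks.isCompact.mul (isCompact_singleton (x := s)))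
          fun v hv => ?_)
      have h1 : k (v * s⁻¹) = 0 := by
        by_contra hne
        exact hv ⟨v * s⁻¹, subset_tsupport k hne, s, rfl, by simp⟩
      rw [h1, smul_zero, zero_smul]
    rw [conv_toLp_leftTrans, conv_toLp_leftTrans, ← integral_sub (hint s) (hint s₀)]
    refine (norm_integral_le_of_norm_le ((hFi s).norm.mul_const ‖g‖)
      (Eventually.of_forall fun v => ?_)).trans_eq (integral_mul_const _ _)
    rw [← sub_smul, norm_smul, LinearIsometry.norm_map]
  rw [ContinuousAt, tendsto_iff_norm_sub_tendsto_zero]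
  refine squeeze_zero (fun _ => norm_nonneg _) (g := fun s => ‖T‖ * ∫ v, ‖F s v‖ ∂μ)
    (fun s => ?_) ?_
  · refine ContinuousLinearMap.opNorm_le_bound _ (by positivity) fun g => ?_
    change ‖T _ - T _‖ ≤ _
    rw [← map_sub, mul_assoc]
    exact T.le_opNorm_of_le (hbound s g)
  · have := (hD.tendsto s₀).const_mul ‖T‖
    simpa [F] using this

/-! ### From invariance to topological invariance -/

/-- `f ↦ m(fT)` as an element of `L_∞(G)`. -/
def orbitFunctional (m : StrongDual ℂ (LInfty μ)) (T : LInfty μ) : LInfty μ :=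
  m.comp ((ContinuousLinearMap.compL ℂ (LOne μ) (LOne μ) ℂ T).comp (conv μ))

theorem orbitFunctional_apply (m : StrongDual ℂ (LInfty μ)) (T : LInfty μ) (f : LOne μ) :
    orbitFunctional μ m T f = m (leftAct μ f T) := rfl

theorem integrable_smul_of_hasCompactSupport {E : Type*} [NormedAddCommGroup E] [NormedSpace ℂ E]
    {f : G → ℂ} (hf : Continuous f) (hfs : HasCompactSupport f) {Φ : G → E} (hΦ : Continuous Φ) :
    Integrable (fun s => f s • Φ s) μ :=
  (hf.smul hΦ).integrable_of_hasCompactSupport hfs.smul_right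

/-- If the orbit of `F` is norm continuous, then `fF` is the norm convergent integral of `f(s)`
times translates of `F`, so a left invariant functional does not separate it from `F` when `∫ f = 1`. -/
theorem map_leftAct_of_continuous_orbit {m : StrongDual ℂ (LInfty μ)}
    (hm : ∀ (t : G) (T : LInfty μ), m (leftTransInfty μ t T) = m T) {F : LInfty μ}
    (hc : Continuous fun s : G => F.comp (leftTrans μ s).toContinuousLinearMap) (f : LOne μ) :
    m (leftAct μ f F) = oneInfty μ f * m F := by
  have hinv : ∀ s, m (F.comp (leftTrans μ s).toContinuousLinearMap) = m F := by
    intro s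
    have := hm s⁻¹ F
    rwa [leftTransInfty, inv_inv] at this
  suffices h : orbitFunctional μ m F = m F • oneInfty μ by
    rw [← orbitFunctional_apply, h, smul_apply, smul_eq_mul, mul_comm]
  refine LInfty.ext_of_hasCompactSupport μ fun f hf hfs hf1 => ?_
  have hint : Integrable
      (fun s => f s • F.comp (leftTrans μ s).toContinuousLinearMap) μ :=
    integrable_smul_of_hasCompactSupport μ hf hfs hc
  have h1 : leftAct μ (hf1.toLp f) F =
      ∫ s, f s • F.comp (leftTrans μ s).toContinuousLinearMap ∂μ := by
    refine ContinuousLinearMap.ext fun g => ?_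
    have h2 : leftAct μ (hf1.toLp f) F g = ∫ s, f s * F (leftTrans μ s g) ∂μ := by
      refine (apply_conv μ (hf1.toLp f) g F).trans (integral_congr_ae ?_)
      filter_upwards [hf1.coeFn_toLp] with s hs
      rw [hs]
    rw [ContinuousLinearMap.integral_apply hint, h2]
    rfl
  have h3 : oneInfty μ (hf1.toLp f) = ∫ s, f s ∂μ := by
    rw [oneInfty_apply, integral_congr_ae hf1.coeFn_toLp]
  rw [orbitFunctional_apply, h1, ← m.integral_comp_comm hint, smul_apply, h3]
  simp only [map_smul, hinv, smul_eq_mul]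
  rw [integral_mul_const, mul_comm]

theorem map_leftAct_conv {m : StrongDual ℂ (LInfty μ)}
    (hm : ∀ (t : G) (T : LInfty μ), m (leftTransInfty μ t T) = m T) (T : LInfty μ)
    (k f : LOne μ) : m (leftAct μ (conv μ k f) T) = oneInfty μ f * m (leftAct μ k T) := by
  have h : (orbitFunctional μ m T).comp ((conv μ).flip f) =
      oneInfty μ f • orbitFunctional μ m T := by
    refine LInfty.ext_of_hasCompactSupport μ fun k hk hks hk1 => ?_
    change m (leftAct μ (conv μ (hk1.toLp k) f) T) = oneInfty μ f * m (leftAct μ (hk1.toLp k) T)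
    rw [← leftAct_leftAct, map_leftAct_of_continuous_orbit μ hm
      (continuous_leftAct_comp_leftTrans μ hk hks hk1 T)]
  exact congrArg (fun S : LInfty μ => S k) h

/-- For a left invariant functional `m`, the value `m(fT)` depends on `f` only through `∫ f`. -/
theorem map_leftAct_eq {m : StrongDual ℂ (LInfty μ)}
    (hm : ∀ (t : G) (T : LInfty μ), m (leftTransInfty μ t T) = m T) (T : LInfty μ)
    (f : LOne μ) {e : LOne μ} (he : e ∈ POne μ) :
    m (leftAct μ f T) = oneInfty μ f * m (leftAct μ e T) := by
  set φ := orbitFunctional μ m T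
  change φ f = oneInfty μ f * φ e
  have he1 : oneInfty μ e = 1 := ((mem_POne_iff μ e).1 he).2
  -- replacing `f` and `e` by `h * f` and `h * e` costs at most `C - 1` times the distance
  set C : ℝ := ‖φ‖ + ‖oneInfty μ f‖ * ‖φ‖ + 1
  have hC : 0 < C := by positivity
  refine eq_of_forall_dist_le fun ε hε => ?_
  obtain ⟨h, hh, h1, h2⟩ := exists_mem_POne_norm_conv_sub_le μ f e (div_pos hε hC)
  have e1 : φ (conv μ h f) = oneInfty μ f * φ h := map_leftAct_conv μ hm T h f
  have e2 : φ (conv μ h e) = φ h := by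
    have := map_leftAct_conv μ hm T h e
    rwa [he1, one_mul] at this
  have key : φ f - oneInfty μ f * φ e =
      oneInfty μ f * φ (conv μ h e - e) - φ (conv μ h f - f) := by
    rw [map_sub, map_sub, e1, e2]
    ring
  rw [dist_eq_norm, key]
  calc _ ≤ ‖oneInfty μ f‖ * (‖φ‖ * (ε / C)) + ‖φ‖ * (ε / C) := by
        refine (norm_sub_le _ _).trans (add_le_add ?_ (φ.le_opNorm_of_le h1))
        rw [norm_mul]
        exact mul_le_mul_of_nonneg_left (φ.le_opNorm_of_le h2) (norm_nonneg _)
    _ = (C - 1) * (ε / C) := by simp only [C]; ring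
    _ ≤ C * (ε / C) := by gcongr; linarith
    _ = ε := mul_div_cancel₀ ε hC.ne'

theorem exists_mem_POne : ∃ e, e ∈ POne μ := by
  obtain ⟨e, he, -⟩ := exists_mem_POne_supported μ (t := 1) univ_mem
  exact ⟨e, he⟩

theorem TLIM_nonempty (hG : IsAmenable μ) : (TLIM μ).Nonempty := by
  obtain ⟨m, ⟨hpos, hone⟩, hm⟩ := hG
  obtain ⟨e, he⟩ := exists_mem_POne μ
  refine ⟨m.comp ((ContinuousLinearMap.compL ℂ (LOne μ) (LOne μ) ℂ).flip (conv μ e)),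
    ⟨fun T hT => ?_, ?_⟩, fun f hf T => ?_⟩
  · exact hpos (leftAct μ e T) fun g hg => hT.apply_conv_nonneg μ he.1 hg
  · change m (leftAct μ e (oneInfty μ)) = 1
    rw [leftAct_oneInfty μ he, hone]
  · change m (leftAct μ e (leftAct μ f T)) = m (leftAct μ e T)
    rw [leftAct_leftAct, map_leftAct_conv μ hm, ((mem_POne_iff μ e).1 he).2, one_mul,
      map_leftAct_eq μ hm T f he, ((mem_POne_iff μ f).1 hf).2, one_mul]

/-! ### Almost invariant densities -/

theorem star_coeFn (g : LOne μ) : ((star g : LOne μ) : G → ℂ) =ᵐ[μ] fun y => star (g y) :=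
  AEEqFun.coeFn_star g.1

/-- Complex conjugation on `L₁(G)`, as a continuous real-linear map. -/
def starL1 : LOne μ →L[ℝ] LOne μ :=
  LinearMap.mkContinuous
    { toFun := star
      map_add' := fun f g => by
        apply Lp.ext
        filter_upwards [star_coeFn μ (f + g), Lp.coeFn_add f g, star_coeFn μ f, star_coeFn μ g,
          Lp.coeFn_add (star f) (star g)] with y h1 h2 h3 h4 h5
        rw [h1, h2, h5, Pi.add_apply, Pi.add_apply, h3, h4, star_add]
      map_smul' := fun c f => by
        apply Lp.ext
        filter_upwards [star_coeFn μ (c • f), Lp.coeFn_smul c f, star_coeFn μ f,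
          Lp.coeFn_smul c (star f)] with y h1 h2 h3 h4
        rw [h1, h2, RingHom.id_apply, h4, Pi.smul_apply, Pi.smul_apply, h3, star_smul,
          star_trivial] }
    1 (fun f => by
      rw [one_mul]
      refine le_of_eq ?_
      rw [L1.norm_eq_integral_norm, L1.norm_eq_integral_norm]
      refine integral_congr_ae ?_
      filter_upwards [star_coeFn μ f] with y hy
      simp only [LinearMap.coe_mk, AddHom.coe_mk, hy, norm_star])

theorem starL1_coeFn (g : LOne μ) : (starL1 μ g : G → ℂ) =ᵐ[μ] fun y => star (g y) :=
  star_coeFn μ g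

theorem starL1_smul (c : ℂ) (g : LOne μ) : starL1 μ (c • g) = star c • starL1 μ g := by
  apply Lp.ext
  filter_upwards [starL1_coeFn μ (c • g), Lp.coeFn_smul c g, starL1_coeFn μ g,
    Lp.coeFn_smul (star c) (starL1 μ g)] with y h1 h2 h3 h4
  rw [h1, h2, h4, Pi.smul_apply, Pi.smul_apply, h3, star_smul]

theorem starL1_eq_self {f : LOne μ} (hf : ∀ᵐ y ∂μ, 0 ≤ f y) : starL1 μ f = f := by
  apply Lp.ext
  filter_upwards [starL1_coeFn μ f, hf] with y h1 h2
  rw [h1]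
  exact (IsSelfAdjoint.of_nonneg h2).star_eq

theorem starL1_leftTrans (s : G) (g : LOne μ) :
    starL1 μ (leftTrans μ s g) = leftTrans μ s (starL1 μ g) := by
  apply Lp.ext
  have h0 := (measurePreserving_mul_left μ s⁻¹).quasiMeasurePreserving.ae_eq_comp
    (starL1_coeFn μ g)
  filter_upwards [starL1_coeFn μ (leftTrans μ s g), leftTrans_coeFn μ s g,
    leftTrans_coeFn μ s (starL1 μ g), h0] with y h1 h2 h3 h4
  simp only [Function.comp_apply] at h4
  rw [h1, h2, h3, h4]

theorem starL1_conv {f : LOne μ} (hf : ∀ᵐ y ∂μ, 0 ≤ f y) (g : LOne μ) :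
    starL1 μ (conv μ f g) = conv μ f (starL1 μ g) := by
  rw [conv_apply, ← (starL1 μ).integral_comp_comm (integrable_smul_leftTrans μ f g), conv_apply]
  refine integral_congr_ae ?_
  filter_upwards [hf] with s hs
  rw [starL1_smul, starL1_leftTrans, (IsSelfAdjoint.of_nonneg hs).star_eq]

/-- The conjugate `T̄` of `T` in `L_∞(G)`: `⟨T̄, g⟩` is the conjugate of `⟨T, ḡ⟩`. -/
def starInfty (T : LInfty μ) : LInfty μ :=
  { toFun := fun g => star (T (starL1 μ g))
    map_add' := fun f g => by rw [map_add, map_add, star_add]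
    map_smul' := fun c g => by
      rw [starL1_smul, map_smul, star_smul, star_star, RingHom.id_apply]
    cont := (T.continuous.comp (starL1 μ).continuous).star }

theorem starInfty_apply (T : LInfty μ) (g : LOne μ) :
    starInfty μ T g = star (T (starL1 μ g)) := rfl

/-- By separation of convex sets, a topologically left invariant mean yields densities that are
almost invariant in norm under finitely many left convolutions. -/
theorem exists_almost_invariant {m : StrongDual ℂ (LInfty μ)} (hm : m ∈ TLIM μ)
    (A : Finset (LOne μ)) (hA : ∀ a ∈ A, a ∈ POne μ) {ε : ℝ} (hε : 0 < ε) :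
    ∃ f ∈ POne μ, ∀ a ∈ A, ‖conv μ a f - f‖ < ε := by
  classical
  obtain ⟨⟨hpos, hone⟩, hinv⟩ := hm
  by_contra! hcon
  let D : LOne μ →L[ℂ] (A → LOne μ) :=
    ContinuousLinearMap.pi fun a => conv μ a - ContinuousLinearMap.id ℂ (LOne μ)
  have hDapp : ∀ f a, D f a = conv μ a f - f := fun f a => rfl
  have hdisj : Disjoint (Metric.ball (0 : A → LOne μ) ε) (D '' POne μ) := by
    rw [Set.disjoint_left]
    rintro _ h ⟨f, hf, rfl⟩
    obtain ⟨a, ha, hle⟩ := hcon f hf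
    rw [mem_ball_zero_iff, pi_norm_lt_iff hε] at h
    exact (h ⟨a, ha⟩).not_ge hle
  have hconv : Convex ℝ (D '' POne μ) :=
    (convex_POne μ).is_linear_image (D.restrictScalars ℝ).toLinearMap.isLinear
  obtain ⟨Λ, u, hΛ1, hΛ2⟩ := RCLike.geometric_hahn_banach_open (𝕜 := ℂ)
    (convex_ball _ _) Metric.isOpen_ball hconv hdisj
  have hu : 0 < u := by
    have := hΛ1 0 (Metric.mem_ball_self hε)
    simpa using this
  -- `S = ∑ (a Tₐ - Tₐ)`, where `Tₐ` is the component of `Λ` at `a`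
  let T : A → LInfty μ := fun a => Λ.comp (ContinuousLinearMap.single ℂ (fun _ => LOne μ) a)
  let S : LInfty μ := Λ.comp D
  have hS : S = ∑ a : A, (leftAct μ a (T a) - T a) := by
    ext f
    have : D f = ∑ a : A, Pi.single a (D f a) := (Finset.univ_sum_single (D f)).symm
    change Λ (D f) = _
    rw [this, map_sum, sum_apply]
    refine Finset.sum_congr rfl fun a _ => ?_
    rw [hDapp]
    exact map_sub (T a) _ _
  have hS' : starInfty μ S = ∑ a : A, (leftAct μ a (starInfty μ (T a)) - starInfty μ (T a)) := by
    ext f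
    rw [starInfty_apply, hS, sum_apply, sum_apply,
      star_sum]
    refine Finset.sum_congr rfl fun a _ => ?_
    have h1 : (leftAct μ a (T a) - T a) (starL1 μ f) =
        T a (starL1 μ (conv μ a f)) - T a (starL1 μ f) := by
      rw [starL1_conv μ (hA a a.2).1]
      rfl
    rw [h1, star_sub]
    rfl
  have hmS : m S = 0 := by
    rw [hS, map_sum]
    exact Finset.sum_eq_zero fun a _ => by rw [map_sub, hinv a (hA a a.2), sub_self]
  have hmS' : m (starInfty μ S) = 0 := by
    rw [hS', map_sum]
    exact Finset.sum_eq_zero fun a _ => by rw [map_sub, hinv a (hA a a.2), sub_self]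
  -- `Re S ≥ u` on densities, so `S + S̄ - 2u ≥ 0`, while `m` takes the value `-2u` there
  have hnn : NonnegInfty μ (S + starInfty μ S - ((2 * u : ℝ) : ℂ) • oneInfty μ) := by
    intro g hg
    have hSg : u * ‖g‖ ≤ (S g).re := by
      rcases eq_or_ne g 0 with rfl | hg0
      · simp
      have hn : 0 < ‖g‖ := norm_pos_iff.2 hg0
      have hP : (‖g‖⁻¹ : ℝ) • g ∈ POne μ := by
        constructor
        · filter_upwards [hg, Lp.coeFn_smul (‖g‖⁻¹ : ℝ) g] with y h1 h2
          rw [h2]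
          exact smul_nonneg (inv_nonneg.2 hn.le) h1
        · rw [norm_smul, norm_inv, norm_norm, inv_mul_cancel₀ hn.ne']
      have h1 := hΛ2 _ ⟨_, hP, rfl⟩
      change u ≤ (S ((‖g‖⁻¹ : ℝ) • g)).re at h1
      rw [S.map_smul_of_tower, Complex.smul_re, smul_eq_mul, inv_mul_eq_div, le_div_iff₀ hn] at h1
      exact h1
    have hval : (S + starInfty μ S - ((2 * u : ℝ) : ℂ) • oneInfty μ) g =
        ((2 * ((S g).re - u * ‖g‖) : ℝ) : ℂ) := by
      change S g + star (S (starL1 μ g)) - ((2 * u : ℝ) : ℂ) * oneInfty μ g = _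
      rw [starL1_eq_self μ hg, oneInfty_eq_norm μ hg]
      apply Complex.ext
      · simp
        ring
      · simp
    rw [hval]
    exact_mod_cast mul_nonneg zero_le_two (sub_nonneg.2 hSg)
  have := hpos _ hnn
  rw [map_sub, map_add, hmS, hmS', map_smul, hone, smul_eq_mul, mul_one, zero_add, zero_sub,
    ← Complex.ofReal_neg] at this
  have h2 : (0 : ℝ) ≤ -(2 * u) := by exact_mod_cast this
  linarith

/-! ### Topologically left invariant means concentrated on a thick set -/

/-- The indicator function of `E` as an element of `L_∞(G)`: `⟨1_E, g⟩ = ∫_E g(x) dx`. -/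
def setInfty (E : Set G) : LInfty μ :=
  LinearMap.mkContinuous
    { toFun := fun g => ∫ y in E, g y ∂μ
      map_add' := fun f g => by
        rw [← integral_add (L1.integrable_coeFn f).integrableOn
          (L1.integrable_coeFn g).integrableOn]
        exact integral_congr_ae (ae_restrict_of_ae (Lp.coeFn_add f g))
      map_smul' := fun c f => by
        rw [RingHom.id_apply, ← integral_smul]
        exact integral_congr_ae (ae_restrict_of_ae (Lp.coeFn_smul c f)) }
    1 (fun g => by
      rw [one_mul, L1.norm_eq_integral_norm]
      refine (norm_integral_le_integral_norm _).trans ?_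
      exact setIntegral_le_integral (L1.integrable_coeFn g).norm
        (Eventually.of_forall fun _ => norm_nonneg _))

theorem setInfty_apply (E : Set G) (g : LOne μ) : setInfty μ E g = ∫ y in E, g y ∂μ := rfl

theorem norm_setInfty_apply_le (E : Set G) (g : LOne μ) : ‖setInfty μ E g‖ ≤ ‖g‖ := by
  rw [setInfty_apply, L1.norm_eq_integral_norm]
  exact (norm_integral_le_integral_norm _).trans (setIntegral_le_integral
    (L1.integrable_coeFn g).norm (Eventually.of_forall fun _ => norm_nonneg _))

theorem norm_oneInfty_apply_le (g : LOne μ) : ‖oneInfty μ g‖ ≤ ‖g‖ := by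
  rw [oneInfty_apply, L1.norm_eq_integral_norm]
  exact norm_integral_le_integral_norm _

theorem setInfty_eq_oneInfty {E : Set G} {g : LOne μ} (hg : ∀ᵐ y ∂μ, y ∉ E → g y = 0) :
    setInfty μ E g = oneInfty μ g := by
  rw [setInfty_apply, oneInfty_apply]
  exact setIntegral_eq_integral_of_ae_compl_eq_zero hg

/-- If `E` contains a right translate of every compact set, the mass of any `f ∈ L₁(G)` can be moved
into `E`, up to `ε`, by a right convolution. -/
theorem exists_setInfty_conv_close {E : Set G} (hE : IsOpen E)
    (hthick : ∀ K : Set G, IsCompact K → ∃ t, ∀ k ∈ K, k * t ∈ E) (f : LOne μ) {ε : ℝ}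
    (hε : 0 < ε) : ∃ h ∈ POne μ, ‖setInfty μ E (conv μ f h) - oneInfty μ f‖ ≤ ε := by
  obtain ⟨k, hkd, hkc, hks⟩ := exists_hasCompactSupport_eLpNorm_one_sub_le μ (Lp.memLp f)
    (ENNReal.ofReal_pos.2 (half_pos hε)).ne'
  have hk : MemLp k 1 μ := memLp_one_iff_integrable.2 (hkc.integrable_of_hasCompactSupport hks)
  have hfk : ‖f - hk.toLp k‖ ≤ ε / 2 := by
    rw [← dist_eq_norm, ← ENNReal.ofReal_le_ofReal_iff (half_pos hε).le, ← edist_dist,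
      Lp.edist_def]
    refine le_trans (le_of_eq (eLpNorm_congr_ae ?_)) hkd
    filter_upwards [hk.coeFn_toLp] with y hy
    rw [Pi.sub_apply, Pi.sub_apply, hy]
  obtain ⟨t, ht⟩ := hthick _ hks.isCompact
  have hV : ∀ᶠ v in 𝓝 t, ∀ s ∈ tsupport k, s * v ∈ E := by
    refine hks.isCompact.eventually_forall_of_forall_eventually fun s hs => ?_
    have hc : Continuous fun z : G × G => z.2 * z.1 := by fun_prop
    exact hc.continuousAt.eventually_mem (hE.mem_nhds (ht s hs))
  obtain ⟨h, hh, hhV⟩ := exists_mem_POne_supported μ hV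
  have hh1 : oneInfty μ h = 1 := ((mem_POne_iff μ h).1 hh).2
  have hval : ∀ s ∈ tsupport k, setInfty μ E (leftTrans μ s h) = 1 := by
    intro s hs
    rw [setInfty_eq_oneInfty, oneInfty_leftTrans, hh1]
    have h0 := (measurePreserving_mul_left μ s⁻¹).quasiMeasurePreserving.ae hhV
    filter_upwards [leftTrans_coeFn μ s h, h0] with y h1 h2 hyE
    rw [h1]
    refine h2 fun h3 => hyE ?_
    simpa using h3 s hs
  have hkh : setInfty μ E (conv μ (hk.toLp k) h) = oneInfty μ (hk.toLp k) := by
    rw [apply_conv, oneInfty_apply]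
    refine integral_congr_ae ?_
    filter_upwards [hk.coeFn_toLp] with s hs
    rw [hs]
    by_cases hsk : s ∈ tsupport k
    · rw [hval s hsk, mul_one]
    · rw [image_eq_zero_of_notMem_tsupport hsk, zero_mul]
  refine ⟨h, hh, ?_⟩
  have key : setInfty μ E (conv μ f h) - oneInfty μ f =
      setInfty μ E (conv μ (f - hk.toLp k) h) - oneInfty μ (f - hk.toLp k) := by
    rw [map_sub (conv μ), sub_apply, map_sub, map_sub, hkh]
    ring
  rw [key]
  calc _ ≤ ‖f - hk.toLp k‖ + ‖f - hk.toLp k‖ := by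
        refine (norm_sub_le _ _).trans (add_le_add ?_ (norm_oneInfty_apply_le μ _))
        refine (norm_setInfty_apply_le μ _ _).trans ((norm_conv_le μ _ _).trans_eq ?_)
        rw [hh.2, mul_one]
    _ ≤ ε := by linarith

/-- If `E` contains a right translate of every compact set, then `E` has full measure for some
topologically left invariant mean. -/
theorem exists_mem_TLIM_setInfty_eq_one (hne : (TLIM μ).Nonempty) {E : Set G} (hE : IsOpen E)
    (hthick : ∀ K : Set G, IsCompact K → ∃ t, ∀ k ∈ K, k * t ∈ E) :
    ∃ m ∈ TLIM μ, m (setInfty μ E) = 1 := by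
  classical
  obtain ⟨m₀, hm₀⟩ := hne
  let ι := Finset (POne μ) × ℕ
  have hex : ∀ i : ι, ∃ g : LOne μ, ‖g‖ ≤ 1 ∧ (∀ T, NonnegInfty μ T → 0 ≤ T g) ∧
      oneInfty μ g = 1 ∧ (∀ a ∈ i.1, ‖conv μ a g - g‖ ≤ 1 / ((i.2 : ℝ) + 1)) ∧
      ‖setInfty μ E g - 1‖ ≤ 1 / ((i.2 : ℝ) + 1) := by
    rintro ⟨A, n⟩
    have hn : 0 < 1 / ((n : ℝ) + 1) := Nat.one_div_pos_of_nat
    obtain ⟨f, hf, hfA⟩ := exists_almost_invariant μ hm₀ (A.map (Function.Embedding.subtype _))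
      (fun a ha => by
        obtain ⟨b, -, rfl⟩ := Finset.mem_map.1 ha
        exact b.2) hn
    obtain ⟨h, hh, hhE⟩ := exists_setInfty_conv_close μ hE hthick f hn
    have hf1 := ((mem_POne_iff μ f).1 hf).2
    have hh1 := ((mem_POne_iff μ h).1 hh).2
    refine ⟨conv μ f h, ?_, fun T hT => hT.apply_conv_nonneg μ hf.1 hh.1, ?_, fun a ha => ?_, ?_⟩
    · simpa [hf.2, hh.2] using norm_conv_le μ f h
    · rw [oneInfty_conv, hf1, hh1, one_mul]
    · have h1 := hfA a (Finset.mem_map.2 ⟨a, ha, rfl⟩)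
      rw [← conv_assoc, ← sub_apply, ← map_sub]
      refine (norm_conv_le μ _ _).trans ?_
      rw [hh.2, mul_one]
      exact h1.le
    · rwa [hf1] at hhE
  choose g hg1 hgpos hgone hginv hgE using hex
  let 𝒰 : Ultrafilter ι := Ultrafilter.of atTop
  have h𝒰 : (𝒰 : Filter ι) ≤ atTop := Ultrafilter.of_le _
  let J : ι → WeakDual ℂ (LInfty μ) := fun i =>
    StrongDual.toWeakDual (NormedSpace.inclusionInDoubleDual ℂ (LOne μ) (g i))
  have hJ : ∀ i, J i ∈ WeakDual.toStrongDual ⁻¹'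
      Metric.closedBall (0 : StrongDual ℂ (LInfty μ)) 1 := by
    intro i
    exact (mem_closedBall_zero_iff (E := StrongDual ℂ (LInfty μ))).2
      ((NormedSpace.double_dual_bound ℂ (LOne μ) (g i)).trans (hg1 i))
  obtain ⟨w, -, hw⟩ := (WeakDual.isCompact_closedBall (𝕜 := ℂ)
    (0 : StrongDual ℂ (LInfty μ)) 1).ultrafilter_le_nhds (𝒰.map J)
      (le_principal_iff.2 (mem_map.2 (univ_mem' hJ)))
  let m : StrongDual ℂ (LInfty μ) := WeakDual.toStrongDual w
  have hlim : ∀ T : LInfty μ, Tendsto (fun i => T (g i)) 𝒰 (𝓝 (m T)) := fun T =>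
    ((WeakDual.eval_continuous T).tendsto w).comp hw
  have hsmall : ∀ ε > 0, ∃ n : ℕ, ∀ k ≥ n, 1 / ((k : ℝ) + 1) ≤ ε := fun ε hε => by
    obtain ⟨n, hn⟩ := exists_nat_one_div_lt hε
    exact ⟨n, fun k hk => (Nat.one_div_le_one_div hk).trans hn.le⟩
  refine ⟨m, ⟨⟨fun T hT => ge_of_tendsto' (hlim T) fun i => hgpos i T hT, ?_⟩,
    fun f hf T => ?_⟩, ?_⟩
  · refine tendsto_nhds_unique (hlim _) ?_
    simp only [hgone]
    exact tendsto_const_nhds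
  · refine eq_of_forall_dist_le fun ε hε => ?_
    obtain ⟨n, hn⟩ := hsmall (ε / (‖T‖ + 1)) (by positivity)
    refine le_of_tendsto ((hlim (leftAct μ f T)).dist (hlim T))
      (h𝒰 ((eventually_ge_atTop (({⟨f, hf⟩}, n) : ι)).mono fun i hi => ?_))
    have h1 : ‖conv μ f (g i) - g i‖ ≤ ε / (‖T‖ + 1) :=
      (hginv i ⟨f, hf⟩ (hi.1 (Finset.mem_singleton_self _))).trans (hn _ hi.2)
    rw [dist_eq_norm]
    calc ‖leftAct μ f T (g i) - T (g i)‖ = ‖T (conv μ f (g i) - g i)‖ := by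
          rw [map_sub]
          rfl
      _ ≤ ‖T‖ * (ε / (‖T‖ + 1)) := T.le_opNorm_of_le h1
      _ ≤ (‖T‖ + 1) * (ε / (‖T‖ + 1)) := by gcongr; linarith
      _ = ε := mul_div_cancel₀ ε (by positivity)
  · refine eq_of_forall_dist_le fun ε hε => ?_
    obtain ⟨n, hn⟩ := hsmall ε hε
    refine le_of_tendsto ((hlim (setInfty μ E)).dist tendsto_const_nhds)
      (h𝒰 ((eventually_ge_atTop ((∅, n) : ι)).mono fun i hi => ?_))
    rw [dist_eq_norm]
    exact (hgE i).trans (hn _ hi.2)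

/-! ### Failure of right invariance -/

theorem setInfty_leftTrans_normIndicator {E : Set G} {A : Set G}
    (hA : MeasurableSet A) (hA' : μ A ≠ ∞) (s : G) :
    setInfty μ E (leftTrans μ s (normIndicator μ A hA hA')) =
      ((μ.real (E ∩ (fun y => s⁻¹ * y) ⁻¹' A) / μ.real A : ℝ) : ℂ) := by
  have h0 := (measurePreserving_mul_left μ s⁻¹).quasiMeasurePreserving.ae_eq_comp
    (normIndicator_coeFn μ A hA hA')
  have h1 : (leftTrans μ s (normIndicator μ A hA hA') : G → ℂ) =ᵐ[μ]
      ((fun y => s⁻¹ * y) ⁻¹' A).indicator fun _ => (((μ.real A)⁻¹ : ℝ) : ℂ) := by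
    filter_upwards [leftTrans_coeFn μ s (normIndicator μ A hA hA'), h0] with y h2 h3
    rw [h2]
    exact h3
  rw [setInfty_apply, integral_congr_ae (ae_restrict_of_ae h1),
    setIntegral_indicator (measurable_const_mul s⁻¹ hA), setIntegral_const, Complex.real_smul,
    ← Complex.ofReal_mul, div_eq_mul_inv]

/-- With `f` and `f'` the normalized indicator functions of `A` and `A x⁻¹`, the functions `1_E f`
and `1_E f'` have at `s` the values `|E ∩ sA| / |A|` and `|Ex ∩ sA| / |A|`. If `E` and `Ex` are
disjoint, their sum is at most `1`, so a right invariant mean cannot give `E` full measure. -/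
theorem notMem_TRIM_of_setInfty_eq_one {E : Set G} (hE : MeasurableSet E) {x : G}
    (hx : ∀ y ∈ E, y * x ∉ E) {m : StrongDual ℂ (LInfty μ)} (hm : m (setInfty μ E) = 1) :
    m ∉ TRIM μ := by
  rintro ⟨⟨hpos, hone⟩, hinv⟩
  obtain ⟨K, hK, hK1⟩ := exists_compact_mem_nhds (1 : G)
  set A := interior K
  have hAne : A.Nonempty := ⟨1, mem_interior_iff_mem_nhds.2 hK1⟩
  have hA : MeasurableSet A := isOpen_interior.measurableSet
  have hAtop : μ A ≠ ∞ := ((measure_mono interior_subset).trans_lt hK.measure_lt_top).ne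
  have hA0 : μ A ≠ 0 := (isOpen_interior.measure_pos μ hAne).ne'
  have hscale : ∀ B : Set G, MeasurableSet B →
      μ ((fun y => y * x) ⁻¹' B) = Measure.modularCharacterFun x • μ B := by
    intro B hB
    rw [← Measure.map_apply (measurable_mul_const x) hB,
      map_mul_right_eq_modularCharacterFun_smul]
    rfl
  have hc : Measure.modularCharacterFun x ≠ 0 := (Measure.modularCharacterFun_pos x).ne'
  set A' := (fun y => y * x) ⁻¹' A
  have hA'm : MeasurableSet A' := measurable_mul_const x hA
  have hA'top : μ A' ≠ ∞ := by
    rw [hscale A hA]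
    exact ENNReal.mul_ne_top ENNReal.coe_ne_top hAtop
  have hA'0 : μ A' ≠ 0 := by
    rw [hscale A hA]
    exact mul_ne_zero (ENNReal.coe_ne_zero.2 hc) hA0
  set f := normIndicator μ A hA hAtop
  set f' := normIndicator μ A' hA'm hA'top
  let a : G → ℝ := fun s => μ.real (E ∩ (fun y => s⁻¹ * y) ⁻¹' A) / μ.real A
  let b : G → ℝ := fun s => μ.real (E ∩ (fun y => s⁻¹ * y) ⁻¹' A') / μ.real A'
  have hab : ∀ s, a s + b s ≤ 1 := by
    intro s
    set sA := (fun y => s⁻¹ * y) ⁻¹' A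
    have hsA : MeasurableSet sA := measurable_const_mul s⁻¹ hA
    have hsAμ : μ sA = μ A := (measurePreserving_mul_left μ s⁻¹).measure_preimage
      hA.nullMeasurableSet
    set Ex := (fun y => y * x⁻¹) ⁻¹' E
    have hEx : MeasurableSet Ex := measurable_mul_const x⁻¹ hE
    have hreal : ∀ B : Set G, MeasurableSet B → μ.real ((fun y => y * x) ⁻¹' B) =
        Measure.modularCharacterFun x * μ.real B := fun B hB => by
      rw [Measure.real, hscale B hB, Measure.real, ENNReal.toReal_smul]
      rfl
    have hset : E ∩ (fun y => s⁻¹ * y) ⁻¹' A' = (fun y => y * x) ⁻¹' (Ex ∩ sA) := by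
      ext y
      simp [A', Ex, sA, mul_assoc]
    have hb : b s = μ.real (Ex ∩ sA) / μ.real A := by
      simp only [b]
      rw [hset, hreal _ (hEx.inter hsA), hreal A hA, mul_div_mul_left]
      exact_mod_cast hc
    have hdisj : Disjoint (E ∩ sA) (Ex ∩ sA) := by
      rw [Set.disjoint_left]
      rintro y ⟨hy, -⟩ ⟨hy', -⟩
      exact hx _ hy' (by simpa using hy)
    have hsAtop : μ sA ≠ ∞ := by rwa [hsAμ]
    have hle : μ.real (E ∩ sA) + μ.real (Ex ∩ sA) ≤ μ.real A := by
      rw [← measureReal_union hdisj (hEx.inter hsA) (measure_ne_top_of_subset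
        Set.inter_subset_right hsAtop) (measure_ne_top_of_subset Set.inter_subset_right hsAtop)]
      have : μ.real A = μ.real sA := by rw [Measure.real, Measure.real, hsAμ]
      rw [this]
      exact measureReal_mono (Set.union_subset Set.inter_subset_right Set.inter_subset_right) hsAtop
    rw [hb]
    simp only [a]
    rw [← add_div]
    exact div_le_one_of_le₀ hle measureReal_nonneg
  have hnn : NonnegInfty μ (oneInfty μ - rightAct μ (setInfty μ E) f -
      rightAct μ (setInfty μ E) f') := by
    intro g hg
    change 0 ≤ oneInfty μ g - setInfty μ E (conv μ g f) - setInfty μ E (conv μ g f')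
    have hi := integrable_mul_apply_leftTrans μ g f (setInfty μ E)
    have hi' := integrable_mul_apply_leftTrans μ g f' (setInfty μ E)
    have hi₀ : Integrable (fun s => g s - g s * setInfty μ E (leftTrans μ s f)) μ :=
      (L1.integrable_coeFn g).sub hi
    rw [apply_conv, apply_conv, oneInfty_apply, ← integral_sub (L1.integrable_coeFn g) hi,
      ← integral_sub hi₀ hi']
    refine integral_nonneg_of_ae ?_
    filter_upwards [hg] with s hs
    have h1 : setInfty μ E (leftTrans μ s f) = (a s : ℂ) :=
      setInfty_leftTrans_normIndicator μ hA hAtop s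
    have h2 : setInfty μ E (leftTrans μ s f') = (b s : ℂ) :=
      setInfty_leftTrans_normIndicator μ hA'm hA'top s
    have h3 : g s - g s * a s - g s * b s = g s * ((1 - a s - b s : ℝ) : ℂ) := by
      push_cast
      ring
    have h4 : (0 : ℝ) ≤ 1 - a s - b s := by linarith [hab s]
    rw [h1, h2, h3]
    exact mul_nonneg hs (by exact_mod_cast h4)
  have := hpos _ hnn
  rw [map_sub, map_sub, hone, hinv f (normIndicator_mem_POne μ A hA hAtop hA0),
    hinv f' (normIndicator_mem_POne μ A' hA'm hA'top hA'0), hm, sub_self, zero_sub] at this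
  have h2 : (0 : ℝ) ≤ -1 := by exact_mod_cast this
  linarith

end TopInvMean

end

theorem mainTheorem3 {G : Type*} [Group G] [TopologicalSpace G] [IsTopologicalGroup G]
    [T2Space G] [LocallyCompactSpace G] [MeasurableSpace G] [BorelSpace G]
    (μ : MeasureTheory.Measure G) [μ.IsHaarMeasure] [μ.Regular]
    (hG : TopInvMean.IsAmenable μ) (x : G)
    (hx : ¬ IsCompact (closure (Set.range fun g : G => g * x * g⁻¹))) :
    TopInvMean.TLIM μ ≠ TopInvMean.TIM μ := by
  obtain ⟨E, hE, hthick, hdisj⟩ := TopInvMean.exists_isOpen_thick hx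
  obtain ⟨m, hm, hmE⟩ := TopInvMean.exists_mem_TLIM_setInfty_eq_one μ
    (TopInvMean.TLIM_nonempty μ hG) hE hthick
  intro h
  rw [h] at hm
  exact TopInvMean.notMem_TRIM_of_setInfty_eq_one μ hE.measurableSet hdisj hmE hm.2
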